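/- Consider the faces (unit equilateral triangles) of the triangular lattice in the plane. A \emph{polyiamond} is a nonempty finite set $P$ of faces that is connected through shared edges (holes are allowed). Its area $\|P\|$ is the number of its faces; its edge-perimeter $p(P)$ is the number of lattice edges that separate a face of $P$ from a face not in $P$; its site-perimeter $s(P)$ is the number of faces not in $P$ that share at least one edge with $P$. For $r\ge 1$ let $E(r)=E_{B_0}(r)$ be the regular lattice hexagon of side length $r$, and let the bar $B(l)$ be the trapezoid of $2l-1$ faces that is the difference of the lattice triangles of side lengths $l$ and $l-1$ sharing a corner. For $1\le i\le 5$, $E_{B_i}(r)$ is obtained by attaching bars along their larger bases to $i$ successive sides of $E(r)$, in cyclic order: the first bar is $B(r)$, and each of the others is a $B(r+1)$ that fits exactly the next side, which the preceding bar has lengthened to $r+1$. (Attaching a sixth bar $B(r+2)$ would yield $E(r+1)$.) A \emph{quasi-regular hexagon} is any translate, by a lattice vector, of any rotation by a multiple of $\pi/3$ of some $E_{B_i}(r)$ with $r\ge1$, $0\le i\le 5$; $\mathcal Q$ is the set of all of them. \textbf{Lemma.} Let $E\in\mathcal Q$. If $P\notin\mathcal Q$ is a polyiamond with $\|P\|\ge\|E\|$,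 then $p(P)>p(E)$ and $s(P)>s(E)$. Consequently $E$ is, up to lattice translations and rotations by multiples of $\pi/3$, the unique minimizer of $p$, and the unique minimizer of $s$, among polyiamonds of its area: $E$ is a polyiamond, and every polyiamond $P$ with $\|P\|=\|E\|$ satisfies $p(P)\ge p(E)$ and $s(P)\ge s(E)$, where equality holds in either inequality if and only if $P$ is obtained from $E$ by such a rotation and translation. -/

import Mathlib

namespace Polyiamond

/-- Vertices of the triangular lattice: `(x, y)` is the point `x + y ω` of the plane, where
`ω = exp (i π / 3)`. The six neighbours of the origin are `±(1, 0)`, `±(0, 1)`, `±(1, -1)`. -/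
abbrev Vertex : Type := ℤ × ℤ

/-- Faces (unit triangles) of the triangular lattice: `((x, y), true)` is the upward triangle whose
lower left vertex is `(x, y)`, and `((x, y), false)` is the downward triangle which together with
it forms the rhombus `(x, y), (x + 1, y), (x + 1, y + 1), (x, y + 1)`. -/
abbrev Face : Type := (ℤ × ℤ) × Bool

/-- The three vertices of a face. -/
def vertices : Face → Finset Vertex
  | ((x, y), true) => {(x, y), (x + 1, y), (x, y + 1)}
  | ((x, y), false) => {(x + 1, y), (x, y + 1), (x + 1, y + 1)}

/-- The three unit edges of a face, as pairs of vertices. -/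
def edges (f : Face) : Finset (Finset Vertex) := (vertices f).powersetCard 2

/-- Two distinct faces are adjacent when they share an edge. -/
def faceGraph : SimpleGraph Face where
  Adj f g := f ≠ g ∧ ∃ e, e ∈ edges f ∧ e ∈ edges g
  symm := ⟨fun _ _ h => ⟨h.1.symm, h.2.imp fun _ he => ⟨he.2, he.1⟩⟩⟩
  loopless := ⟨fun _ h => h.1 rfl⟩

/-- A polyiamond: a (nonempty) finite edge-connected set of faces. It may have holes. -/
def IsPolyiamond (P : Finset Face) : Prop := (faceGraph.induce (P : Set Face)).Connected

/-- The area: the number of triangular units. -/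
def area (P : Finset Face) : ℕ := P.card

/-- The boundary: the unit edges that separate a face of `P` from a face outside `P`. -/
def boundary (P : Finset Face) : Set (Finset Vertex) :=
  {e | ∃ f ∈ P, ∃ g ∉ P, e ∈ edges f ∧ e ∈ edges g}

/-- The edge-perimeter: the number of boundary edges. -/
noncomputable def edgePerimeter (P : Finset Face) : ℕ := (boundary P).ncard

/-- The site-perimeter: the number of empty faces that share at least one edge with `P`. -/
noncomputable def sitePerimeter (P : Finset Face) : ℕ :=
  {g : Face | g ∉ P ∧ ∃ f ∈ P, faceGraph.Adj f g}.ncard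

/-- Translation of faces by a lattice vector. -/
def translate (v : Vertex) (f : Face) : Face := (f.1 + v, f.2)

/-- Rotation of vertices about the origin by `π / 3`: multiplication by `ω`, with `ω² = ω - 1`. -/
def rotateVertex (v : Vertex) : Vertex := (-v.2, v.1 + v.2)

/-- Rotation of faces about the origin by `π / 3`. -/
def rotate : Face → Face
  | ((x, y), true) => ((-y - 1, x + y), false)
  | ((x, y), false) => ((-y - 1, x + y + 1), true)

theorem vertices_translate (v : Vertex) (f : Face) :
    vertices (translate v f) = (vertices f).image (· + v) := by
  obtain ⟨⟨x, y⟩, b⟩ := f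
  obtain ⟨a, c⟩ := v
  cases b <;> ext ⟨p, q⟩ <;> simp [vertices, translate] <;> grind

theorem vertices_rotate (f : Face) : vertices (rotate f) = (vertices f).image rotateVertex := by
  obtain ⟨⟨x, y⟩, b⟩ := f
  cases b <;> ext ⟨p, q⟩ <;> simp [vertices, rotate, rotateVertex] <;> grind

/-- `Q` is obtained from `P` by a rotation by a multiple of `π / 3` and a translation. -/
def Congruent (P Q : Finset Face) : Prop :=
  ∃ (z : ℕ) (v : Vertex), Q = (P.image (rotate^[z])).image (translate v)

/-- The regular hexagon `E(r)` of radius (side length) `r` centred at the origin: all faces whose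
vertices are at lattice distance at most `r` from the origin. -/
noncomputable def regularHexagon (r : ℕ) : Finset Face :=
  ((Finset.Icc (-(r : ℤ)) r ×ˢ Finset.Icc (-(r : ℤ)) r) ×ˢ Finset.univ).filter fun f =>
    ∀ v ∈ vertices f, |v.1| ≤ (r : ℤ) ∧ |v.2| ≤ (r : ℤ) ∧ |v.1 + v.2| ≤ (r : ℤ)

/-- The equilateral triangle with vertices `(0, 0)`, `(l, 0)`, `(0, l)`. -/
noncomputable def triangle (l : ℕ) : Finset Face :=
  ((Finset.Icc (0 : ℤ) l ×ˢ Finset.Icc (0 : ℤ) l) ×ˢ Finset.univ).filter fun f =>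
    ∀ v ∈ vertices f, 0 ≤ v.1 ∧ 0 ≤ v.2 ∧ v.1 + v.2 ≤ (l : ℤ)

/-- The bar `B(l)`, `l ≥ 1`: the triangle of side `l` without the triangle of side `l - 1` at its
top. It has `2 l - 1` faces; its larger base is the segment from `(0, 0)` to `(l, 0)`. -/
noncomputable def bar (l : ℕ) : Finset Face := triangle l \ (triangle (l - 1)).image (translate (0, 1))

/-- The quasi-regular hexagon `E_{B_i}(r)` in standard position, for `i ≤ 5`: bars are attached
along their larger bases to successive sides of `E(r)`, counter-clockwise from the top side, which
runs from `(-r, r)` to `(0, r)`. The first bar is a `B(r)`. Each bar lengthens the next side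
to `r + 1`, so that the following ones are `B(r + 1)`. (A sixth bar, `B(r + 2)`, would complete
`E(r + 1)`.) -/
noncomputable def quasiRegularHexagon (r : ℕ) : ℕ → Finset Face
  | 0 => regularHexagon r
  | i + 1 => quasiRegularHexagon r i ∪
      ((bar (if i = 0 then r else r + 1)).image (translate (-(r : ℤ), (r : ℤ)))).image (rotate^[i])

/-- The set of all quasi-regular hexagons: all translates and rotates of the `E_{B_i}(r)`, where
`r ≥ 1` and `0 ≤ i ≤ 5`. As `E_{B_6}(r) = E(r + 1)`, the value `i = 6` is covered. -/
def IsQuasiRegularHexagon (P : Finset Face) : Prop :=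
  ∃ r i : ℕ, 1 ≤ r ∧ i ≤ 5 ∧ Congruent (quasiRegularHexagon r i) P

end Polyiamond

/-! Every face lies in one strip of each of the three directions, so it has coordinates `x`, `y`,
`zIndex`, and crossing an edge changes exactly one of them, by one. A strip that meets `P` contains,
just beyond the two ends of `P` in it, two empty faces with exactly one of their two neighbours in
the strip belonging to `P`. An empty face can play this role in at most two of the three directions,
so the number of strips that meet `P`, summed over the directions, is at most `s(P)`. Moreover `s(P)
≤ p(P)`, so lower bounds for `s` serve both perimeters.

Since `P` is connected, the strips it meets are consecutive in each direction. Hence `P` lies in a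
lattice hexagon (`hull`) whose three widths have a sum `n ≤ s(P)` (`exists_hull`). If `N` is the
area of that hexagon, then `n² - 6N = a² + 3d² + 3w²` for integers `a`, `d`, `w` that measure its
irregularity. For `E_{B_i}(r)` both perimeters equal `6r + i`, and six times the area is `(6r + i)²
- defect i` with `defect i ≤ 7`.

If `‖P‖ ≥ ‖E‖`, this forces `n ≥ 6r + i`, as consecutive squares are too far apart
(`le_semiWidth_of_area_le`). If also `s(P) ≤ 6r + i`, then `n = 6r + i` and `a² + 3d² + 3w² ≤ defect
i`. Only finitely many triples remain; all of them attain `defect i` and describe rotations of `E`,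
so `P` fills its hexagon and is congruent to `E` (`congruent_of_area_le`). -/

namespace Polyiamond

/-! ### Strip coordinates, neighbours and adjacency -/

/-- The index of the strip between two consecutive lines `x + y = const` that contains a face. -/
def zIndex : Face → ℤ
  | ((x, y), true) => x + y
  | ((x, y), false) => x + y + 1

/-- The neighbour across the edge on a line `x = const`. -/
def nbrX : Face → Face
  | ((x, y), true) => ((x - 1, y), false)
  | ((x, y), false) => ((x + 1, y), true)

/-- The neighbour across the edge on a line `y = const`. -/
def nbrY : Face → Face
  | ((x, y), true) => ((x, y - 1), false)
  | ((x, y), false) => ((x, y + 1), true)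

/-- The neighbour across the edge on a line `x + y = const`. -/
def nbrZ : Face → Face
  | ((x, y), true) => ((x, y), false)
  | ((x, y), false) => ((x, y), true)

theorem edges_true (x y : ℤ) : edges ((x, y), true) =
    {{(x, y), (x + 1, y)}, {(x, y), (x, y + 1)}, {(x + 1, y), (x, y + 1)}} := by
  have h : (vertices ((x, y), true)).card = 3 := by
    simp [vertices, Finset.card_insert_of_notMem]
  ext e
  simp only [edges, Finset.mem_powersetCard, Finset.mem_insert, Finset.mem_singleton]
  constructor
  · rintro ⟨hs, hc⟩
    obtain ⟨a, b, hab, rfl⟩ := Finset.card_eq_two.1 hc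
    have ha := hs (Finset.mem_insert_self a _)
    have hb := hs (Finset.mem_insert_of_mem (Finset.mem_singleton_self b))
    simp only [vertices, Finset.mem_insert, Finset.mem_singleton] at ha hb
    rcases ha with rfl | rfl | rfl <;> rcases hb with rfl | rfl | rfl <;>
      simp_all [Finset.pair_comm]
  · rintro (rfl | rfl | rfl) <;> constructor <;>
      simp [vertices, Finset.insert_subset_iff, Finset.card_insert_of_notMem]

theorem edges_false (x y : ℤ) : edges ((x, y), false) =
    {{(x, y + 1), (x + 1, y + 1)}, {(x + 1, y), (x + 1, y + 1)}, {(x + 1, y), (x, y + 1)}} := by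
  ext e
  simp only [edges, Finset.mem_powersetCard, Finset.mem_insert, Finset.mem_singleton]
  constructor
  · rintro ⟨hs, hc⟩
    obtain ⟨a, b, hab, rfl⟩ := Finset.card_eq_two.1 hc
    have ha := hs (Finset.mem_insert_self a _)
    have hb := hs (Finset.mem_insert_of_mem (Finset.mem_singleton_self b))
    simp only [vertices, Finset.mem_insert, Finset.mem_singleton] at ha hb
    rcases ha with rfl | rfl | rfl <;> rcases hb with rfl | rfl | rfl <;>
      simp_all [Finset.pair_comm]
  · rintro (rfl | rfl | rfl) <;> constructor <;>
      simp [vertices, Finset.insert_subset_iff, Finset.card_insert_of_notMem]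

theorem pair_eq_pair_iff {a b c d : Vertex} :
    ({a, b} : Finset Vertex) = {c, d} ↔ a = c ∧ b = d ∨ a = d ∧ b = c := by
  rw [← Finset.coe_inj]
  simp only [Finset.coe_insert, Finset.coe_singleton]
  exact Set.pair_eq_pair_iff

/-- Two distinct faces share an edge exactly when one is the neighbour of the other across it. -/
theorem shared_edge {f g : Face} {e : Finset Vertex} (hfg : f ≠ g) (hf : e ∈ edges f)
    (hg : e ∈ edges g) : g = nbrX f ∨ g = nbrY f ∨ g = nbrZ f := by
  obtain ⟨⟨x, y⟩, b⟩ := f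
  obtain ⟨⟨x', y'⟩, b'⟩ := g
  cases b <;> cases b' <;>
    simp only [edges_true, edges_false, Finset.mem_insert, Finset.mem_singleton] at hf hg <;>
    rcases hf with rfl | rfl | rfl <;>
    simp only [pair_eq_pair_iff, Prod.mk.injEq] at hg <;>
    simp only [nbrX, nbrY, nbrZ, Prod.mk.injEq, ne_eq, and_true, and_false, reduceCtorEq] at hfg ⊢ <;>
    omega

theorem adj_iff {f g : Face} : faceGraph.Adj f g ↔ g = nbrX f ∨ g = nbrY f ∨ g = nbrZ f := by
  constructor
  · rintro ⟨hne, e, hf, hg⟩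
    exact shared_edge hne hf hg
  · obtain ⟨⟨x, y⟩, b⟩ := f
    intro h
    cases b
    · rcases h with rfl | rfl | rfl
      · exact ⟨by simp [nbrX], {(x + 1, y), (x + 1, y + 1)}, by simp [edges_false],
          by simp [nbrX, edges_true]⟩
      · exact ⟨by simp [nbrY], {(x, y + 1), (x + 1, y + 1)}, by simp [edges_false],
          by simp [nbrY, edges_true]⟩
      · exact ⟨by simp [nbrZ], {(x + 1, y), (x, y + 1)}, by simp [edges_false],
          by simp [nbrZ, edges_true]⟩
    · rcases h with rfl | rfl | rfl
      · exact ⟨by simp [nbrX], {(x, y), (x, y + 1)}, by simp [edges_true],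
          by simp [nbrX, edges_false]⟩
      · exact ⟨by simp [nbrY], {(x, y), (x + 1, y)}, by simp [edges_true],
          by simp [nbrY, edges_false]⟩
      · exact ⟨by simp [nbrZ], {(x + 1, y), (x, y + 1)}, by simp [edges_true],
          by simp [nbrZ, edges_false]⟩

theorem nbrX_nbrX (f : Face) : nbrX (nbrX f) = f := by
  obtain ⟨⟨x, y⟩, b⟩ := f; cases b <;> simp [nbrX]

theorem nbrY_nbrY (f : Face) : nbrY (nbrY f) = f := by
  obtain ⟨⟨x, y⟩, b⟩ := f; cases b <;> simp [nbrY]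

theorem nbrZ_nbrZ (f : Face) : nbrZ (nbrZ f) = f := by
  obtain ⟨⟨x, y⟩, b⟩ := f; cases b <;> simp [nbrZ]

/-- An edge lies on at most two faces. -/
theorem eq_of_shared_edge {f g g' : Face} {e : Finset Vertex} (hf : e ∈ edges f) (hg : e ∈ edges g)
    (hg' : e ∈ edges g') (hfg : f ≠ g) (hfg' : f ≠ g') : g = g' := by
  by_contra hne
  have h1 := shared_edge hfg hf hg
  have h2 := shared_edge hfg' hf hg'
  have h3 := shared_edge hne hg hg'
  obtain ⟨⟨x, y⟩, b⟩ := f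
  cases b <;> rcases h1 with rfl | rfl | rfl <;> rcases h2 with rfl | rfl | rfl <;>
    simp [nbrX, nbrY, nbrZ] at h3 hne

/-! ### Boundary edges and boundary sites -/

/-- The empty faces that share an edge with `P`. -/
def sites (P : Finset Face) : Finset Face :=
  (P.image nbrX ∪ P.image nbrY ∪ P.image nbrZ) \ P

theorem mem_sites {P : Finset Face} {g : Face} :
    g ∈ sites P ↔ g ∉ P ∧ (nbrX g ∈ P ∨ nbrY g ∈ P ∨ nbrZ g ∈ P) := by
  simp only [sites, Finset.mem_sdiff, Finset.mem_union, Finset.mem_image]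
  constructor
  · rintro ⟨(⟨f, hf, rfl⟩ | ⟨f, hf, rfl⟩) | ⟨f, hf, rfl⟩, hg⟩
    · exact ⟨hg, Or.inl (by rwa [nbrX_nbrX])⟩
    · exact ⟨hg, Or.inr (Or.inl (by rwa [nbrY_nbrY]))⟩
    · exact ⟨hg, Or.inr (Or.inr (by rwa [nbrZ_nbrZ]))⟩
  · rintro ⟨hg, h | h | h⟩
    · exact ⟨Or.inl (Or.inl ⟨_, h, nbrX_nbrX g⟩), hg⟩
    · exact ⟨Or.inl (Or.inr ⟨_, h, nbrY_nbrY g⟩), hg⟩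
    · exact ⟨Or.inr ⟨_, h, nbrZ_nbrZ g⟩, hg⟩

theorem coe_sites (P : Finset Face) :
    {g : Face | g ∉ P ∧ ∃ f ∈ P, faceGraph.Adj f g} = (sites P : Set Face) := by
  ext g
  simp only [Set.mem_ofPred_eq, Finset.mem_coe, mem_sites]
  refine and_congr_right fun _ => ⟨?_, ?_⟩
  · rintro ⟨f, hf, h⟩
    rcases adj_iff.1 h.symm with rfl | rfl | rfl <;> simp [hf]
  · rintro (h | h | h)
    · exact ⟨_, h, (adj_iff.2 (Or.inl rfl)).symm⟩
    · exact ⟨_, h, (adj_iff.2 (Or.inr (Or.inl rfl))).symm⟩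
    · exact ⟨_, h, (adj_iff.2 (Or.inr (Or.inr rfl))).symm⟩

theorem sitePerimeter_eq (P : Finset Face) : sitePerimeter P = (sites P).card := by
  rw [sitePerimeter, coe_sites, Set.ncard_coe_finset]

theorem boundary_finite (P : Finset Face) : (boundary P).Finite := by
  refine (P.biUnion edges).finite_toSet.subset ?_
  rintro e ⟨f, hf, g, -, he, -⟩
  exact Finset.mem_coe.2 (Finset.mem_biUnion.2 ⟨f, hf, he⟩)

/-- Choose for each site an edge it shares with `P`. One side of that edge is a face of `P`, and an
edge has at most two sides, so the choice is injective. -/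
theorem sitePerimeter_le_edgePerimeter (P : Finset Face) :
    sitePerimeter P ≤ edgePerimeter P := by
  have key : ∀ g ∈ {g : Face | g ∉ P ∧ ∃ f ∈ P, faceGraph.Adj f g},
      ∃ e, (∃ f ∈ P, e ∈ edges f) ∧ e ∈ edges g := by
    rintro g ⟨-, f, hf, -, e, h1, h2⟩
    exact ⟨e, ⟨f, hf, h1⟩, h2⟩
  choose! φ hφ using key
  refine Set.ncard_le_ncard_of_injOn φ ?_ ?_ (boundary_finite P)
  · intro g hg
    obtain ⟨⟨f, hf, h1⟩, h2⟩ := hφ g hg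
    exact ⟨f, hf, g, hg.1, h1, h2⟩
  · intro g hg g' hg' heq
    obtain ⟨⟨f, hf, h1⟩, h2⟩ := hφ g hg
    obtain ⟨-, h3⟩ := hφ g' hg'
    rw [← heq] at h3
    exact eq_of_shared_edge h1 h2 h3 (fun h => hg.1 (h ▸ hf)) (fun h => hg'.1 (h ▸ hf))

/-! ### Counting strips -/

/-- The witnesses are `max S + 1` and `min S - 1`. For `S` the positions of `P` along a strip, these
are the two empty faces with exactly one neighbour of the strip in `P`. -/
theorem exists_ends_of_finite {S : Set ℤ} (hS : S.Finite) (hne : S.Nonempty) :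
    ∃ a b, b < a ∧ (a ∉ S ∧ a - 1 ∈ S ∧ a + 1 ∉ S) ∧ (b ∉ S ∧ b + 1 ∈ S ∧ b - 1 ∉ S) := by
  obtain ⟨M, hM, hM'⟩ := hS.exists_maximal hne
  obtain ⟨m, hm, hm'⟩ := hS.exists_minimal hne
  have h1 : ∀ k ∈ S, k ≤ M := fun k hk => by
    by_contra h; exact h (hM' hk (by omega))
  have h2 : ∀ k ∈ S, m ≤ k := fun k hk => by
    by_contra h; exact h (hm' hk (by omega))
  refine ⟨M + 1, m - 1, ?_, ⟨fun h => ?_, by simpa using hM, fun h => ?_⟩,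
    fun h => ?_, by simpa using hm, fun h => ?_⟩
  · have := h1 m hm; omega
  · have := h1 _ h; omega
  · have := h1 _ h; omega
  · have := h2 _ h; omega
  · have := h2 _ h; omega

/-- If the faces are arranged in strips, where `path k` runs through strip `k` and `n₁`, `n₂` are
the two neighbours of a face in its strip, then every strip that meets `P` contains at least two
empty faces with exactly one of these two neighbours in `P`. -/
theorem two_mul_card_strips_le {P T : Finset Face} {n₁ n₂ : Face → Face} (c : Face → ℤ)
    (path : ℤ → ℤ → Face) (hinj : ∀ k, Function.Injective (path k))
    (hc : ∀ k m, c (path k m) = k) (hsurj : ∀ f, ∃ m, path (c f) m = f)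
    (hn : ∀ k m, n₁ (path k m) = path k (m - 1) ∧ n₂ (path k m) = path k (m + 1) ∨
      n₁ (path k m) = path k (m + 1) ∧ n₂ (path k m) = path k (m - 1))
    (hT : ∀ g, g ∉ P → ¬ (n₁ g ∈ P ↔ n₂ g ∈ P) → g ∈ T) {I : Finset ℤ}
    (hI : ∀ k ∈ I, ∃ f ∈ P, c f = k) : 2 * I.card ≤ T.card := by
  have h2 : ∀ k ∈ I, 2 ≤ (T.filter fun f => c f = k).card := by
    intro k hk
    obtain ⟨f, hf, rfl⟩ := hI k hk
    obtain ⟨m, hm⟩ := hsurj f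
    have hfin : {m | path (c f) m ∈ P}.Finite :=
      P.finite_toSet.preimage (hinj (c f)).injOn
    obtain ⟨a, b, hab, ⟨ha, ha1, ha2⟩, hb, hb1, hb2⟩ :=
      exists_ends_of_finite hfin ⟨m, by simpa [hm] using hf⟩
    simp only [Set.mem_ofPred_eq] at ha ha1 ha2 hb hb1 hb2
    rw [← Finset.card_pair (show path (c f) a ≠ path (c f) b from
      fun h => hab.ne' (hinj _ h))]
    refine Finset.card_le_card ?_
    intro g hg
    simp only [Finset.mem_insert, Finset.mem_singleton] at hg
    rcases hg with rfl | rfl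
    · refine Finset.mem_filter.2 ⟨hT _ ha ?_, hc _ _⟩
      rcases hn (c f) a with ⟨e1, e2⟩ | ⟨e1, e2⟩ <;> rw [e1, e2] <;> tauto
    · refine Finset.mem_filter.2 ⟨hT _ hb ?_, hc _ _⟩
      rcases hn (c f) b with ⟨e1, e2⟩ | ⟨e1, e2⟩ <;> rw [e1, e2] <;> tauto
  calc 2 * I.card = ∑ _k ∈ I, 2 := by rw [Finset.sum_const, smul_eq_mul, mul_comm]
    _ ≤ ∑ k ∈ I, (T.filter fun f => c f = k).card := Finset.sum_le_sum h2
    _ = (T.filter fun f => c f ∈ I).card := by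
        rw [Finset.card_eq_sum_card_fiberwise (s := T.filter fun f => c f ∈ I) (f := c) (t := I)
          (fun f hf => (Finset.mem_filter.1 hf).2)]
        refine Finset.sum_congr rfl fun k hk => ?_
        congr 1
        ext f
        simp only [Finset.mem_filter]
        constructor
        · rintro ⟨h, rfl⟩; exact ⟨⟨h, hk⟩, rfl⟩
        · rintro ⟨⟨h, -⟩, h'⟩; exact ⟨h, h'⟩
    _ ≤ T.card := Finset.card_filter_le _ _

/-- The site-perimeter is at least the number of strips, in all three directions, that meet `P`. -/
theorem card_strips_le_sitePerimeter {P : Finset Face} {I J K : Finset ℤ}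
    (hI : ∀ k ∈ I, ∃ f ∈ P, f.1.1 = k) (hJ : ∀ k ∈ J, ∃ f ∈ P, f.1.2 = k)
    (hK : ∀ k ∈ K, ∃ f ∈ P, zIndex f = k) :
    I.card + J.card + K.card ≤ sitePerimeter P := by
  classical
  rw [sitePerimeter_eq]
  -- Along a strip upward (`m` even) and downward (`m` odd) faces alternate, and `m / 2` is a
  -- lattice coordinate. The orientation decides which of the two neighbours comes next, whence the
  -- parity split below.
  have h1 := two_mul_card_strips_le (P := P) (n₁ := nbrY) (n₂ := nbrZ)
    (T := (sites P).filter fun g => ¬ (nbrY g ∈ P ↔ nbrZ g ∈ P)) (fun f => f.1.1)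
    (fun k m => ((k, m / 2), decide (m % 2 = 0)))
    (by
      intro k m m' h
      simp only [Prod.mk.injEq, true_and, decide_eq_decide] at h
      omega)
    (fun _ _ => rfl)
    (by
      rintro ⟨⟨x, y⟩, b⟩
      cases b
      · exact ⟨2 * y + 1, by simp; omega⟩
      · exact ⟨2 * y, by simp⟩)
    (by
      intro k m
      rcases Int.emod_two_eq_zero_or_one m with h | h
      · left
        simp [h, nbrY, nbrZ]; omega
      · right
        simp [h, nbrY, nbrZ]; omega)
    (fun g hg h => Finset.mem_filter.2 ⟨mem_sites.2 ⟨hg, by tauto⟩, h⟩) hI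
  have h2 := two_mul_card_strips_le (P := P) (n₁ := nbrX) (n₂ := nbrZ)
    (T := (sites P).filter fun g => ¬ (nbrX g ∈ P ↔ nbrZ g ∈ P)) (fun f => f.1.2)
    (fun k m => ((m / 2, k), decide (m % 2 = 0)))
    (by
      intro k m m' h
      simp only [Prod.mk.injEq, and_true, decide_eq_decide] at h
      omega)
    (fun _ _ => rfl)
    (by
      rintro ⟨⟨x, y⟩, b⟩
      cases b
      · exact ⟨2 * x + 1, by simp; omega⟩
      · exact ⟨2 * x, by simp⟩)
    (by
      intro k m
      rcases Int.emod_two_eq_zero_or_one m with h | h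
      · left
        simp [h, nbrX, nbrZ]; omega
      · right
        simp [h, nbrX, nbrZ]; omega)
    (fun g hg h => Finset.mem_filter.2 ⟨mem_sites.2 ⟨hg, by tauto⟩, h⟩) hJ
  have h3 := two_mul_card_strips_le (P := P) (n₁ := nbrX) (n₂ := nbrY)
    (T := (sites P).filter fun g => ¬ (nbrX g ∈ P ↔ nbrY g ∈ P)) zIndex
    (fun k m => ((m / 2, k - m / 2 - m % 2), decide (m % 2 = 0)))
    (by
      intro k m m' h
      simp only [Prod.mk.injEq, decide_eq_decide] at h
      omega)
    (by
      intro k m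
      rcases Int.emod_two_eq_zero_or_one m with h | h <;> simp [h, zIndex]
      ring)
    (by
      rintro ⟨⟨x, y⟩, b⟩
      cases b
      · exact ⟨2 * x + 1, by simp [zIndex]; omega⟩
      · exact ⟨2 * x, by simp [zIndex]⟩)
    (by
      intro k m
      rcases Int.emod_two_eq_zero_or_one m with h | h
      · left
        simp [h, nbrX, nbrY]; omega
      · right
        simp [h, nbrX, nbrY]; omega)
    (fun g hg h => Finset.mem_filter.2 ⟨mem_sites.2 ⟨hg, by tauto⟩, h⟩) hK
  -- Among three truth values either none or exactly two of the three pairs disagree, so each site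
  -- is counted at most twice.
  have h4 : ((sites P).filter fun g => ¬ (nbrY g ∈ P ↔ nbrZ g ∈ P)).card +
      ((sites P).filter fun g => ¬ (nbrX g ∈ P ↔ nbrZ g ∈ P)).card +
      ((sites P).filter fun g => ¬ (nbrX g ∈ P ↔ nbrY g ∈ P)).card ≤ 2 * (sites P).card := by
    rw [Finset.card_filter, Finset.card_filter, Finset.card_filter, ← Finset.sum_add_distrib,
      ← Finset.sum_add_distrib, mul_comm, ← smul_eq_mul, ← Finset.sum_const]
    refine Finset.sum_le_sum fun g _ => ?_
    by_cases a : nbrX g ∈ P <;> by_cases b : nbrY g ∈ P <;> by_cases c : nbrZ g ∈ P <;>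
      simp [a, b, c]
  omega

/-! ### Hexagons as boxes in strip coordinates -/

/-- The (possibly degenerate) hexagon of all faces between the lines `x = x₀` and `x = x₁`, `y = y₀`
and `y = y₁`, `x + y = z₀` and `x + y = z₁`. -/
noncomputable def hull (x₀ x₁ y₀ y₁ z₀ z₁ : ℤ) : Finset Face :=
  ((Finset.Ico x₀ x₁ ×ˢ Finset.Ico y₀ y₁) ×ˢ Finset.univ).filter
    fun f => z₀ ≤ zIndex f ∧ zIndex f < z₁

theorem mem_hull {x₀ x₁ y₀ y₁ z₀ z₁ : ℤ} {f : Face} : f ∈ hull x₀ x₁ y₀ y₁ z₀ z₁ ↔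
    (x₀ ≤ f.1.1 ∧ f.1.1 < x₁) ∧ (y₀ ≤ f.1.2 ∧ f.1.2 < y₁) ∧ z₀ ≤ zIndex f ∧ zIndex f < z₁ := by
  simp [hull, and_assoc]

theorem rotate_injective : Function.Injective rotate := by
  rintro ⟨⟨x, y⟩, b⟩ ⟨⟨x', y'⟩, b'⟩ h
  cases b <;> cases b' <;> simp [rotate] at h ⊢ <;> omega

theorem translate_injective (v : Vertex) : Function.Injective (translate v) := by
  rintro ⟨a, b⟩ ⟨a', b'⟩ h
  simpa [translate] using h

/-- In strip coordinates the rotation is `(x, y, z) ↦ (-y - 1, z, x)`; the `-1` is absorbed by the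
half-open bounds. -/
theorem image_rotate_hull (x₀ x₁ y₀ y₁ z₀ z₁ : ℤ) :
    (hull x₀ x₁ y₀ y₁ z₀ z₁).image rotate = hull (-y₁) (-y₀) z₀ z₁ x₀ x₁ := by
  ext ⟨⟨x, y⟩, b⟩
  simp only [Finset.mem_image, mem_hull]
  constructor
  · rintro ⟨⟨⟨x', y'⟩, b'⟩, h, h'⟩
    cases b' <;> simp only [rotate, Prod.mk.injEq] at h' <;>
      obtain ⟨⟨rfl, rfl⟩, rfl⟩ := h' <;> simp only [zIndex] at h ⊢ <;> omega
  · intro h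
    cases b
    · refine ⟨((y + x + 1, -x - 1), true), ?_, ?_⟩
      · simp only [zIndex] at h ⊢; omega
      · simp only [rotate, Prod.mk.injEq, and_true]; omega
    · refine ⟨((y + x, -x - 1), false), ?_, ?_⟩
      · simp only [zIndex] at h ⊢; omega
      · simp only [rotate, Prod.mk.injEq, and_true]; omega

theorem image_translate_hull (v : Vertex) (x₀ x₁ y₀ y₁ z₀ z₁ : ℤ) :
    (hull x₀ x₁ y₀ y₁ z₀ z₁).image (translate v) =
      hull (x₀ + v.1) (x₁ + v.1) (y₀ + v.2) (y₁ + v.2) (z₀ + (v.1 + v.2)) (z₁ + (v.1 + v.2)) := by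
  obtain ⟨a, c⟩ := v
  ext ⟨⟨x, y⟩, b⟩
  simp only [Finset.mem_image, mem_hull]
  constructor
  · rintro ⟨⟨⟨x', y'⟩, b'⟩, h, h'⟩
    simp only [translate, Prod.mk.injEq, Prod.mk_add_mk] at h'
    obtain ⟨⟨rfl, rfl⟩, rfl⟩ := h'
    cases b' <;> simp only [zIndex] at h ⊢ <;> omega
  · intro h
    refine ⟨((x - a, y - c), b), ?_, by simp [translate]⟩
    cases b <;> simp only [zIndex] at h ⊢ <;> omega

/-! ### The area of a hexagon -/

/-- A triangle of side `t + 1` is one of side `t` together with a row of `t + 1` upward and `t`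
downward faces. -/
theorem card_hull_corner (x y : ℤ) (t : ℕ) :
    (hull x (x + t) y (y + t) (x + y) (x + y + t)).card = t ^ 2 := by
  induction t with
  | zero => simp [hull]
  | succ t ih =>
    have h : hull x (x + (t + 1 : ℕ)) y (y + (t + 1 : ℕ)) (x + y) (x + y + (t + 1 : ℕ)) =
        hull x (x + t) y (y + t) (x + y) (x + y + t) ∪
        ((Finset.range (t + 1)).image (fun k : ℕ => (((x + k, y + t - k), true) : Face)) ∪
          (Finset.range t).image (fun k : ℕ => (((x + k, y + t - 1 - k), false) : Face))) := by
      ext ⟨⟨a, c⟩, b⟩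
      simp only [Finset.mem_union, mem_hull, Finset.mem_image, Finset.mem_range, Prod.mk.injEq]
      constructor
      · intro h
        cases b
        · simp only [zIndex] at h ⊢
          by_cases h' : a + c + 1 < x + y + t
          · left; push_cast at h; omega
          · right; right
            exact ⟨(a - x).toNat, by push_cast at h; omega, ⟨by omega, by push_cast at h; omega⟩,
              trivial⟩
        · simp only [zIndex] at h ⊢
          by_cases h' : a + c < x + y + t
          · left; push_cast at h; omega
          · right; left
            exact ⟨(a - x).toNat, by push_cast at h; omega, ⟨by omega, by push_cast at h; omega⟩,
              trivial⟩
      · rintro (h | ⟨k, hk, ⟨rfl, rfl⟩, rfl⟩ | ⟨k, hk, ⟨rfl, rfl⟩, rfl⟩)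
        · push_cast; omega
        · simp only [zIndex]; push_cast; omega
        · simp only [zIndex]; push_cast; omega
    rw [h, Finset.card_union_of_disjoint, Finset.card_union_of_disjoint, ih,
      Finset.card_image_of_injective, Finset.card_image_of_injective, Finset.card_range,
      Finset.card_range]
    · ring
    · intro k k' h; simpa using h
    · intro k k' h; simpa using h
    · rw [Finset.disjoint_left]
      intro f hf hf'
      simp only [Finset.mem_image] at hf hf'
      obtain ⟨k, -, rfl⟩ := hf
      obtain ⟨k', -, h⟩ := hf'
      simp at h
    · rw [Finset.disjoint_left]
      intro f hf hf'
      simp only [Finset.mem_union, Finset.mem_image, mem_hull] at hf hf'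
      rcases hf' with ⟨k, -, rfl⟩ | ⟨k, -, rfl⟩ <;> simp only [zIndex] at hf <;> omega

/-- The area of a hexagon: a parallelogram without the triangles at two opposite corners. -/
theorem card_hull {x₀ x₁ y₀ y₁ z₀ z₁ : ℤ} (h₁ : x₀ + y₀ ≤ z₀) (h₂ : z₀ ≤ x₁ + y₀)
    (h₃ : z₀ ≤ x₀ + y₁) (h₄ : z₁ ≤ x₁ + y₁) (h₅ : x₁ + y₀ ≤ z₁) (h₆ : x₀ + y₁ ≤ z₁)
    (hz : z₀ ≤ z₁) :
    ((hull x₀ x₁ y₀ y₁ z₀ z₁).card : ℤ) =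
      2 * (x₁ - x₀) * (y₁ - y₀) - (z₀ - x₀ - y₀) ^ 2 - (x₁ + y₁ - z₁) ^ 2 := by
  obtain ⟨t, ht⟩ := Int.eq_ofNat_of_zero_le (show 0 ≤ z₀ - x₀ - y₀ by omega)
  obtain ⟨u, hu⟩ := Int.eq_ofNat_of_zero_le (show 0 ≤ x₁ + y₁ - z₁ by omega)
  -- Three rotations make a half-turn, which carries the corner triangle at `(-x₁, -y₁)` to the one
  -- at the opposite corner of the parallelogram.
  have hU : (hull (x₁ - u) x₁ (y₁ - u) y₁ z₁ (z₁ + u)).card = u ^ 2 := by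
    have h := card_hull_corner (-x₁) (-y₁) u
    rw [← Finset.card_image_of_injective _ rotate_injective,
      ← Finset.card_image_of_injective _ rotate_injective,
      ← Finset.card_image_of_injective _ rotate_injective, image_rotate_hull, image_rotate_hull,
      image_rotate_hull] at h
    rw [← h]
    congr 2 <;> omega
  have hT := card_hull_corner x₀ y₀ t
  have hpar : ((Finset.Ico x₀ x₁ ×ˢ Finset.Ico y₀ y₁) ×ˢ (Finset.univ : Finset Bool)) =
      hull x₀ x₁ y₀ y₁ z₀ z₁ ∪ (hull x₀ (x₀ + t) y₀ (y₀ + t) (x₀ + y₀) (x₀ + y₀ + t) ∪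
        hull (x₁ - u) x₁ (y₁ - u) y₁ z₁ (z₁ + u)) := by
    ext ⟨⟨x, y⟩, b⟩
    simp only [Finset.mem_union, mem_hull, Finset.mem_product, Finset.mem_Ico, Finset.mem_univ,
      and_true]
    cases b <;> simp only [zIndex] <;> omega
  have hcard := congrArg Finset.card hpar
  rw [Finset.card_union_of_disjoint, Finset.card_union_of_disjoint, hT, hU, Finset.card_product,
    Finset.card_product, Int.card_Ico, Int.card_Ico, Finset.card_univ, Fintype.card_bool] at hcard
  · have hA : ((x₁ - x₀).toNat : ℤ) = x₁ - x₀ := Int.toNat_of_nonneg (by omega)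
    have hB : ((y₁ - y₀).toNat : ℤ) = y₁ - y₀ := Int.toNat_of_nonneg (by omega)
    have := congrArg (Nat.cast : ℕ → ℤ) hcard
    push_cast [hA, hB] at this
    rw [ht, hu]
    linarith
  · rw [Finset.disjoint_left]
    intro f hf hf'
    rw [mem_hull] at hf hf'
    omega
  · rw [Finset.disjoint_left]
    intro f hf hf'
    rw [Finset.mem_union, mem_hull, mem_hull] at hf'
    rw [mem_hull] at hf
    omega

/-! ### The edge-perimeter of a hexagon -/

/-- The lengths of the six sides add up to the sum of the widths. Only this upper bound is needed:
strip counting supplies the reverse inequality for quasi-regular hexagons. -/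
theorem edgePerimeter_hull_le {x₀ x₁ y₀ y₁ z₀ z₁ : ℤ} (h₁ : x₀ + y₀ ≤ z₀) (h₂ : z₀ ≤ x₁ + y₀)
    (h₃ : z₀ ≤ x₀ + y₁) (h₄ : z₁ ≤ x₁ + y₁) (h₅ : x₁ + y₀ ≤ z₁) (h₆ : x₀ + y₁ ≤ z₁) :
    (edgePerimeter (hull x₀ x₁ y₀ y₁ z₀ z₁) : ℤ) ≤ (x₁ - x₀) + (y₁ - y₀) + (z₁ - z₀) := by
  let B : Finset (Finset Vertex) :=
    (Finset.Ico (z₀ - x₀) y₁).image (fun y => {(x₀, y), (x₀, y + 1)}) ∪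
    (Finset.Ico y₀ (z₁ - x₁)).image (fun y => {(x₁, y), (x₁, y + 1)}) ∪
    (Finset.Ico (z₀ - y₀) x₁).image (fun x => {(x, y₀), (x + 1, y₀)}) ∪
    (Finset.Ico x₀ (z₁ - y₁)).image (fun x => {(x, y₁), (x + 1, y₁)}) ∪
    (Finset.Ico x₀ (z₀ - y₀)).image (fun x => {(x + 1, z₀ - 1 - x), (x, z₀ - x)}) ∪
    (Finset.Ico (z₁ - y₁) x₁).image (fun x => {(x + 1, z₁ - 1 - x), (x, z₁ - x)})
  have hsub : boundary (hull x₀ x₁ y₀ y₁ z₀ z₁) ⊆ (B : Set (Finset Vertex)) := by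
    rintro e ⟨f, hf, g, hg, hef, heg⟩
    have hfg : f ≠ g := fun h => hg (h ▸ hf)
    have hadj := shared_edge hfg hef heg
    obtain ⟨⟨x, y⟩, b⟩ := f
    rw [mem_hull] at hf hg
    -- Two distinct faces share only one edge, so `e` is identified by exhibiting any common edge of
    -- `f` and `g`.
    have key : ∀ e', e' ∈ edges ((x, y), b) → e' ∈ edges g → e = e' := by
      intro e' h1 h2
      cases b <;> rcases hadj with rfl | rfl | rfl <;>
        simp only [edges_true, edges_false, nbrX, nbrY, nbrZ, Finset.mem_insert,
          Finset.mem_singleton] at hef heg h1 h2 <;>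
        rcases hef with rfl | rfl | rfl <;> simp only [pair_eq_pair_iff, Prod.mk.injEq] at heg <;>
        rcases h1 with rfl | rfl | rfl <;> simp only [pair_eq_pair_iff, Prod.mk.injEq] at h2 <;>
        first
          | rfl
          | omega
    simp only [B, Finset.coe_union, Set.mem_union, Finset.mem_coe, Finset.mem_image,
      Finset.mem_Ico]
    cases b <;> rcases hadj with rfl | rfl | rfl <;> simp only [nbrX, nbrY, nbrZ, zIndex] at hf hg
    · refine Or.inl (Or.inl (Or.inl (Or.inl (Or.inr ⟨y, by omega, ?_⟩))))
      rw [key {(x + 1, y), (x + 1, y + 1)} (by simp [edges_false]) (by simp [nbrX, edges_true])]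
      rw [show x₁ = x + 1 by omega]
    · refine Or.inl (Or.inl (Or.inr ⟨x, by omega, ?_⟩))
      rw [key {(x, y + 1), (x + 1, y + 1)} (by simp [edges_false]) (by simp [nbrY, edges_true])]
      rw [show y₁ = y + 1 by omega]
    · refine Or.inl (Or.inr ⟨x, by omega, ?_⟩)
      rw [key {(x + 1, y), (x, y + 1)} (by simp [edges_false]) (by simp [nbrZ, edges_true])]
      rw [show z₀ - 1 - x = y by omega, show z₀ - x = y + 1 by omega]
    · refine Or.inl (Or.inl (Or.inl (Or.inl (Or.inl ⟨y, by omega, ?_⟩))))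
      rw [key {(x, y), (x, y + 1)} (by simp [edges_true]) (by simp [nbrX, edges_false])]
      rw [show x₀ = x by omega]
    · refine Or.inl (Or.inl (Or.inl (Or.inr ⟨x, by omega, ?_⟩)))
      rw [key {(x, y), (x + 1, y)} (by simp [edges_true]) (by simp [nbrY, edges_false])]
      rw [show y₀ = y by omega]
    · refine Or.inr ⟨x, by omega, ?_⟩
      rw [key {(x + 1, y), (x, y + 1)} (by simp [edges_true]) (by simp [nbrZ, edges_false])]
      rw [show z₁ - 1 - x = y by omega, show z₁ - x = y + 1 by omega]
  have hle : edgePerimeter (hull x₀ x₁ y₀ y₁ z₀ z₁) ≤ B.card := by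
    rw [← Set.ncard_coe_finset B]
    exact Set.ncard_le_ncard hsub B.finite_toSet
  have hB : B.card ≤ (y₁ - (z₀ - x₀)).toNat + (z₁ - x₁ - y₀).toNat + (x₁ - (z₀ - y₀)).toNat +
      (z₁ - y₁ - x₀).toNat + (z₀ - y₀ - x₀).toNat + (x₁ - (z₁ - y₁)).toNat := by
    simp only [← Int.card_Ico]
    refine (Finset.card_union_le _ _).trans (add_le_add ?_ Finset.card_image_le)
    refine (Finset.card_union_le _ _).trans (add_le_add ?_ Finset.card_image_le)
    refine (Finset.card_union_le _ _).trans (add_le_add ?_ Finset.card_image_le)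
    refine (Finset.card_union_le _ _).trans (add_le_add ?_ Finset.card_image_le)
    exact (Finset.card_union_le _ _).trans (add_le_add Finset.card_image_le Finset.card_image_le)
  omega

/-! ### Connectedness of a hexagon -/

/-- The bounds place the six faces around the origin inside the hexagon. From any other face one can
step towards them without leaving it. -/
theorem isPolyiamond_hull {x₀ x₁ y₀ y₁ z₀ z₁ : ℤ} (hx₀ : x₀ ≤ -1) (hx₁ : 1 ≤ x₁) (hy₀ : y₀ ≤ -1)
    (hy₁ : 1 ≤ y₁) (hz₀ : z₀ ≤ -1) (hz₁ : 1 ≤ z₁) : IsPolyiamond (hull x₀ x₁ y₀ y₁ z₀ z₁) := by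
  set H := hull x₀ x₁ y₀ y₁ z₀ z₁ with hH
  have h0 : (((0, 0), true) : Face) ∈ H := by
    rw [hH, mem_hull]; simp only [zIndex]; omega
  have step : ∀ (f g : Face) (hf : f ∈ H) (hg : g ∈ H), (g = nbrX f ∨ g = nbrY f ∨ g = nbrZ f) →
      (faceGraph.induce (H : Set Face)).Reachable ⟨g, hg⟩ ⟨_, h0⟩ →
      (faceGraph.induce (H : Set Face)).Reachable ⟨f, hf⟩ ⟨_, h0⟩ := by
    intro f g hf hg h hr
    refine SimpleGraph.Reachable.trans (SimpleGraph.Adj.reachable ?_) hr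
    exact adj_iff.2 h
  have r0 : (faceGraph.induce (H : Set Face)).Reachable ⟨_, h0⟩ ⟨_, h0⟩ :=
    SimpleGraph.Reachable.refl _
  have mem : ∀ x y b, (-1 ≤ x ∧ x ≤ 0) → (-1 ≤ y ∧ y ≤ 0) →
      (-1 ≤ zIndex ((x, y), b) ∧ zIndex ((x, y), b) ≤ 0) → ((x, y), b) ∈ H := by
    intro x y b h1 h2 h3
    rw [hH, mem_hull]; dsimp only; omega
  have m1 := mem (-1) 0 false (by omega) (by omega) (by simp [zIndex])
  have m2 := mem (-1) 0 true (by omega) (by omega) (by simp [zIndex])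
  have m3 := mem (-1) (-1) false (by omega) (by omega) (by simp [zIndex])
  have m4 := mem 0 (-1) true (by omega) (by omega) (by simp [zIndex])
  have m5 := mem 0 (-1) false (by omega) (by omega) (by simp [zIndex])
  have r1 := step _ _ m1 h0 (by simp [nbrX]) r0
  have r2 := step _ _ m2 m1 (by simp [nbrZ]) r1
  have r5 := step _ _ m5 h0 (by simp [nbrY]) r0
  have r4 := step _ _ m4 m5 (by simp [nbrZ]) r5
  have r3 := step _ _ m3 m4 (by simp [nbrX]) r4
  -- The measure is three exactly on the six central faces, where every coordinate is `-1` or `0`.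
  -- Elsewhere some neighbour moves one coordinate towards the centre and lowers it by two.
  have main : ∀ (n : ℕ) (f : Face) (hf : f ∈ H),
      (2 * f.1.1 + 1).natAbs + (2 * f.1.2 + 1).natAbs + (2 * zIndex f + 1).natAbs ≤ n →
      (faceGraph.induce (H : Set Face)).Reachable ⟨f, hf⟩ ⟨_, h0⟩ := by
    intro n
    induction n with
    | zero => intro f hf h; exfalso; omega
    | succ n ih =>
      rintro ⟨⟨x, y⟩, b⟩ hf h
      have hf' := hf
      rw [hH, mem_hull] at hf'
      cases b <;> simp only [zIndex] at h hf'
      · by_cases c1 : x ≤ -2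
        · have m : nbrX ((x, y), false) ∈ H := by
            rw [hH, mem_hull]; simp only [nbrX, zIndex]; omega
          exact step _ _ hf m (Or.inl rfl) (ih _ m (by simp only [nbrX, zIndex]; omega))
        by_cases c2 : y ≤ -2
        · have m : nbrY ((x, y), false) ∈ H := by
            rw [hH, mem_hull]; simp only [nbrY, zIndex]; omega
          exact step _ _ hf m (Or.inr (Or.inl rfl)) (ih _ m (by simp only [nbrY, zIndex]; omega))
        by_cases c3 : 1 ≤ x + y + 1
        · have m : nbrZ ((x, y), false) ∈ H := by
            rw [hH, mem_hull]; simp only [nbrZ, zIndex]; omega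
          exact step _ _ hf m (Or.inr (Or.inr rfl)) (ih _ m (by simp only [nbrZ, zIndex]; omega))
        obtain ⟨rfl, rfl⟩ | ⟨rfl, rfl⟩ | ⟨rfl, rfl⟩ :
          (x = -1 ∧ y = 0) ∨ (x = -1 ∧ y = -1) ∨ (x = 0 ∧ y = -1) := by omega
        exacts [r1, r3, r5]
      · by_cases c1 : 1 ≤ x
        · have m : nbrX ((x, y), true) ∈ H := by
            rw [hH, mem_hull]; simp only [nbrX, zIndex]; omega
          exact step _ _ hf m (Or.inl rfl) (ih _ m (by simp only [nbrX, zIndex]; omega))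
        by_cases c2 : 1 ≤ y
        · have m : nbrY ((x, y), true) ∈ H := by
            rw [hH, mem_hull]; simp only [nbrY, zIndex]; omega
          exact step _ _ hf m (Or.inr (Or.inl rfl)) (ih _ m (by simp only [nbrY, zIndex]; omega))
        by_cases c3 : x + y ≤ -2
        · have m : nbrZ ((x, y), true) ∈ H := by
            rw [hH, mem_hull]; simp only [nbrZ, zIndex]; omega
          exact step _ _ hf m (Or.inr (Or.inr rfl)) (ih _ m (by simp only [nbrZ, zIndex]; omega))
        obtain ⟨rfl, rfl⟩ | ⟨rfl, rfl⟩ | ⟨rfl, rfl⟩ :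
          (x = 0 ∧ y = 0) ∨ (x = -1 ∧ y = 0) ∨ (x = 0 ∧ y = -1) := by omega
        exacts [r0, r2, r4]
  have : Nonempty (H : Set Face) := ⟨⟨_, h0⟩⟩
  refine SimpleGraph.Connected.mk fun a b => ?_
  have hr : ∀ a : (H : Set Face), (faceGraph.induce (H : Set Face)).Reachable a ⟨_, h0⟩ :=
    fun a => main _ a.1 a.2 le_rfl
  exact (hr a).trans (hr b).symm

/-! ### The hexagonal hull of a polyiamond -/

/-- A discrete intermediate value theorem: along a walk `c` rises by at most one per step, so it
cannot pass from below `k` to above `k` without taking the value `k`. -/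
theorem exists_range_of_connected {P : Finset Face} (hP : IsPolyiamond P) (c : Face → ℤ)
    (hc : ∀ f g, faceGraph.Adj f g → c g ≤ c f + 1) :
    ∃ a b, a < b ∧ (∀ f ∈ P, a ≤ c f ∧ c f < b) ∧ ∀ k ∈ Finset.Ico a b, ∃ f ∈ P, c f = k := by
  obtain ⟨⟨f₀, hf₀⟩⟩ := hP.nonempty
  obtain ⟨m, hm, hm'⟩ := P.exists_min_image c ⟨f₀, hf₀⟩
  obtain ⟨M, hM, hM'⟩ := P.exists_max_image c ⟨f₀, hf₀⟩
  refine ⟨c m, c M + 1, by have := hm' M hM; omega,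
    fun f hf => ⟨hm' f hf, by have := hM' f hf; omega⟩, fun k hk => ?_⟩
  rw [Finset.mem_Ico] at hk
  by_contra! hno
  have hstay : ∀ a b : (P : Set Face), (faceGraph.induce (P : Set Face)).Walk a b →
      c a.1 < k → c b.1 < k := by
    intro a b w
    induction w with
    | nil => exact id
    | @cons u v w h _ ih =>
      intro hu
      refine ih ?_
      have h1 := hc _ _ (show faceGraph.Adj u.1 v.1 from h)
      have h2 := hno v.1 v.2
      omega
  have hlt : c m < k := lt_of_le_of_ne hk.1 (hno m hm)
  obtain ⟨w⟩ := hP.preconnected ⟨m, hm⟩ ⟨M, hM⟩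
  have := hstay _ _ w hlt
  dsimp only at this
  omega

/-- A polyiamond lies in a nondegenerate hexagon whose semi-sum of widths bounds its
site-perimeter from below. -/
theorem exists_hull {P : Finset Face} (hP : IsPolyiamond P) : ∃ x₀ x₁ y₀ y₁ z₀ z₁ : ℤ,
    P ⊆ hull x₀ x₁ y₀ y₁ z₀ z₁ ∧ x₀ < x₁ ∧ y₀ < y₁ ∧ z₀ < z₁ ∧
    x₀ + y₀ ≤ z₀ ∧ z₀ ≤ x₁ + y₀ ∧ z₀ ≤ x₀ + y₁ ∧ z₁ ≤ x₁ + y₁ ∧ x₁ + y₀ ≤ z₁ ∧ x₀ + y₁ ≤ z₁ ∧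
    (x₁ - x₀) + (y₁ - y₀) + (z₁ - z₀) ≤ sitePerimeter P := by
  obtain ⟨x₀, x₁, hx, hx', hX⟩ := exists_range_of_connected hP (fun f => f.1.1) (by
    rintro ⟨⟨x, y⟩, b⟩ g h
    cases b <;> rcases adj_iff.1 h with rfl | rfl | rfl <;> (simp [nbrX, nbrY, nbrZ]; try omega))
  obtain ⟨y₀, y₁, hy, hy', hY⟩ := exists_range_of_connected hP (fun f => f.1.2) (by
    rintro ⟨⟨x, y⟩, b⟩ g h
    cases b <;> rcases adj_iff.1 h with rfl | rfl | rfl <;> (simp [nbrX, nbrY, nbrZ]; try omega))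
  obtain ⟨z₀, z₁, hz, hz', hZ⟩ := exists_range_of_connected hP zIndex (by
    rintro ⟨⟨x, y⟩, b⟩ g h
    cases b <;> rcases adj_iff.1 h with rfl | rfl | rfl <;> 
      (simp [nbrX, nbrY, nbrZ, zIndex]; try omega))
  have hs := card_strips_le_sitePerimeter hX hY hZ
  simp only [Int.card_Ico] at hs
  -- Each of the six nondegeneracy inequalities follows by applying this to a face of `P` in an
  -- extreme strip.
  have hr : ∀ f : Face, f.1.1 + f.1.2 ≤ zIndex f ∧ zIndex f ≤ f.1.1 + f.1.2 + 1 := by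
    rintro ⟨⟨x, y⟩, b⟩; cases b <;> simp [zIndex]
  obtain ⟨f₁, hf₁, e₁⟩ := hX x₀ (by simpa using hx)
  obtain ⟨f₂, hf₂, e₂⟩ := hX (x₁ - 1) (by simp; omega)
  obtain ⟨f₃, hf₃, e₃⟩ := hY y₀ (by simpa using hy)
  obtain ⟨f₄, hf₄, e₄⟩ := hY (y₁ - 1) (by simp; omega)
  obtain ⟨f₅, hf₅, e₅⟩ := hZ z₀ (by simpa using hz)
  obtain ⟨f₆, hf₆, e₆⟩ := hZ (z₁ - 1) (by simp; omega)
  have b₁ := hx' f₁ hf₁; have b₁' := hy' f₁ hf₁; have b₁'' := hz' f₁ hf₁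
  have b₂ := hx' f₂ hf₂; have b₂' := hy' f₂ hf₂; have b₂'' := hz' f₂ hf₂
  have b₃ := hx' f₃ hf₃; have b₃' := hy' f₃ hf₃; have b₃'' := hz' f₃ hf₃
  have b₄ := hx' f₄ hf₄; have b₄' := hy' f₄ hf₄; have b₄'' := hz' f₄ hf₄
  have b₅ := hx' f₅ hf₅; have b₅' := hy' f₅ hf₅; have b₅'' := hz' f₅ hf₅
  have b₆ := hx' f₆ hf₆; have b₆' := hy' f₆ hf₆; have b₆'' := hz' f₆ hf₆
  have c₁ := hr f₁; have c₂ := hr f₂; have c₃ := hr f₃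
  have c₄ := hr f₄; have c₅ := hr f₅; have c₆ := hr f₆
  exact ⟨x₀, x₁, y₀, y₁, z₀, z₁, fun f hf => mem_hull.2 ⟨hx' f hf, hy' f hf, hz' f hf⟩,
    by omega, by omega, by omega, by omega, by omega, by omega, by omega, by omega, by omega,
    by omega⟩

/-! ### Symmetries of the lattice -/

/-- A bijection of the faces that is induced by an injective map of the vertices. -/
def IsLatticeSymmetry (φ : Face → Face) : Prop :=
  Function.Bijective φ ∧ ∃ ψ : Vertex → Vertex, Function.Injective ψ ∧
    ∀ f, vertices (φ f) = (vertices f).image ψ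

theorem IsLatticeSymmetry.comp {φ φ' : Face → Face} (h : IsLatticeSymmetry φ)
    (h' : IsLatticeSymmetry φ') : IsLatticeSymmetry (φ ∘ φ') := by
  obtain ⟨hb, ψ, hψ, hv⟩ := h
  obtain ⟨hb', ψ', hψ', hv'⟩ := h'
  exact ⟨hb.comp hb', ψ ∘ ψ', hψ.comp hψ', fun f => by
    rw [Function.comp_apply, hv, hv', Finset.image_image]⟩

theorem rotate_iterate_six (f : Face) : rotate^[6] f = f := by
  obtain ⟨⟨x, y⟩, b⟩ := f
  cases b <;> simp only [Function.iterate_succ, Function.iterate_zero, Function.comp, id, rotate,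
    Prod.mk.injEq, and_true] <;> omega

theorem rotateVertex_injective : Function.Injective rotateVertex := by
  rintro ⟨x, y⟩ ⟨x', y'⟩ h
  simp only [rotateVertex, Prod.mk.injEq] at h ⊢
  omega

theorem isLatticeSymmetry_rotate : IsLatticeSymmetry rotate :=
  ⟨⟨rotate_injective, fun f => ⟨rotate^[5] f, by
    rw [← Function.iterate_succ_apply' rotate, rotate_iterate_six]⟩⟩,
    rotateVertex, rotateVertex_injective, vertices_rotate⟩

theorem isLatticeSymmetry_rotate_iterate (z : ℕ) : IsLatticeSymmetry rotate^[z] := by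
  induction z with
  | zero => exact ⟨Function.bijective_id, id, Function.injective_id, fun f => by simp⟩
  | succ z ih =>
    rw [Function.iterate_succ]
    exact ih.comp isLatticeSymmetry_rotate

theorem isLatticeSymmetry_translate (v : Vertex) : IsLatticeSymmetry (translate v) :=
  ⟨⟨translate_injective v, fun f => ⟨translate (-v) f, by simp [translate]⟩⟩,
    (· + v), add_left_injective v, vertices_translate v⟩

theorem Congruent.exists_symmetry {P Q : Finset Face} (h : Congruent P Q) :
    ∃ φ, IsLatticeSymmetry φ ∧ Q = P.image φ := by
  obtain ⟨z, v, rfl⟩ := h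
  exact ⟨_, (isLatticeSymmetry_translate v).comp (isLatticeSymmetry_rotate_iterate z),
    Finset.image_image⟩

theorem edges_map {φ : Face → Face} {ψ : Vertex → Vertex} (hψ : Function.Injective ψ)
    (hv : ∀ f, vertices (φ f) = (vertices f).image ψ) (f : Face) :
    edges (φ f) = (edges f).image (Finset.image ψ) := by
  have h : Finset.image ψ = Finset.map ⟨ψ, hψ⟩ := by
    ext s; simp
  rw [edges, hv, h, Finset.powersetCard_map, edges, Finset.map_eq_image]
  rfl

theorem IsLatticeSymmetry.edgePerimeter_image {φ : Face → Face} (h : IsLatticeSymmetry φ)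
    (P : Finset Face) : edgePerimeter (P.image φ) = edgePerimeter P := by
  obtain ⟨hb, ψ, hψ, hv⟩ := h
  have hb' : boundary (P.image φ) = (Finset.image ψ) '' boundary P := by
    ext e
    constructor
    · rintro ⟨f, hf, g, hg, hef, heg⟩
      obtain ⟨f, hf', rfl⟩ := Finset.mem_image.1 hf
      obtain ⟨g, rfl⟩ := hb.2 g
      rw [edges_map hψ hv] at hef heg
      obtain ⟨e₁, h₁, rfl⟩ := Finset.mem_image.1 hef
      obtain ⟨e₂, h₂, h₁₂⟩ := Finset.mem_image.1 heg
      rw [Finset.image_injective hψ h₁₂] at h₂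
      exact ⟨e₁, ⟨f, hf', g, fun h => hg (Finset.mem_image_of_mem _ h), h₁, h₂⟩, rfl⟩
    · rintro ⟨e, ⟨f, hf, g, hg, hef, heg⟩, rfl⟩
      refine ⟨φ f, Finset.mem_image_of_mem _ hf, φ g, ?_, ?_, ?_⟩
      · rw [hb.1.mem_finset_image]; exact hg
      · rw [edges_map hψ hv]; exact Finset.mem_image_of_mem _ hef
      · rw [edges_map hψ hv]; exact Finset.mem_image_of_mem _ heg
  rw [edgePerimeter, hb', Set.ncard_image_of_injective _ (Finset.image_injective hψ), edgePerimeter]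

theorem IsLatticeSymmetry.adj_iff {φ : Face → Face} (h : IsLatticeSymmetry φ) {f g : Face} :
    faceGraph.Adj (φ f) (φ g) ↔ faceGraph.Adj f g := by
  obtain ⟨hb, ψ, hψ, hv⟩ := h
  refine and_congr hb.1.ne_iff ?_
  rw [edges_map hψ hv, edges_map hψ hv]
  constructor
  · rintro ⟨e, h₁, h₂⟩
    obtain ⟨e₁, h₁', rfl⟩ := Finset.mem_image.1 h₁
    obtain ⟨e₂, h₂', h₁₂⟩ := Finset.mem_image.1 h₂
    rw [Finset.image_injective hψ h₁₂] at h₂'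
    exact ⟨e₁, h₁', h₂'⟩
  · rintro ⟨e, h₁, h₂⟩
    exact ⟨_, Finset.mem_image_of_mem _ h₁, Finset.mem_image_of_mem _ h₂⟩

theorem IsLatticeSymmetry.sitePerimeter_image {φ : Face → Face} (h : IsLatticeSymmetry φ)
    (P : Finset Face) : sitePerimeter (P.image φ) = sitePerimeter P := by
  have hs : {g : Face | g ∉ P.image φ ∧ ∃ f ∈ P.image φ, faceGraph.Adj f g} =
      φ '' {g : Face | g ∉ P ∧ ∃ f ∈ P, faceGraph.Adj f g} := by
    ext g
    constructor
    · rintro ⟨hg, f, hf, hfg⟩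
      obtain ⟨f, hf', rfl⟩ := Finset.mem_image.1 hf
      obtain ⟨g, rfl⟩ := h.1.2 g
      exact ⟨g, ⟨fun hg' => hg (Finset.mem_image_of_mem _ hg'), f, hf', h.adj_iff.1 hfg⟩, rfl⟩
    · rintro ⟨g, ⟨hg, f, hf, hfg⟩, rfl⟩
      exact ⟨by rwa [h.1.1.mem_finset_image], φ f, Finset.mem_image_of_mem _ hf, h.adj_iff.2 hfg⟩
  rw [sitePerimeter, hs, Set.ncard_image_of_injective _ h.1.1, sitePerimeter]

theorem IsLatticeSymmetry.isPolyiamond_image {φ : Face → Face} (h : IsLatticeSymmetry φ)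
    {P : Finset Face} (hP : IsPolyiamond P) : IsPolyiamond (P.image φ) := by
  let F : faceGraph.induce (P : Set Face) →g faceGraph.induce (P.image φ : Set Face) :=
    ⟨fun f => ⟨φ f.1, Finset.mem_coe.2 (Finset.mem_image_of_mem _ f.2)⟩,
      fun {a b} hab => h.adj_iff.2 (show faceGraph.Adj a.1 b.1 from hab)⟩
  refine SimpleGraph.Connected.map F ?_ hP
  rintro ⟨g, hg⟩
  obtain ⟨f, hf, rfl⟩ := Finset.mem_image.1 (Finset.mem_coe.1 hg)
  exact ⟨⟨f, hf⟩, rfl⟩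

/-! ### Congruence -/

theorem rotate_translate (v : Vertex) (f : Face) :
    rotate (translate v f) = translate (rotateVertex v) (rotate f) := by
  obtain ⟨⟨x, y⟩, b⟩ := f
  obtain ⟨a, c⟩ := v
  cases b <;> simp only [rotate, translate, rotateVertex, Prod.mk_add_mk, Prod.mk.injEq, and_true]
    <;> omega

theorem rotate_iterate_translate (z : ℕ) (v : Vertex) (f : Face) :
    rotate^[z] (translate v f) = translate (rotateVertex^[z] v) (rotate^[z] f) := by
  induction z with
  | zero => rfl
  | succ z ih => simp only [Function.iterate_succ_apply', ih, rotate_translate]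

theorem Congruent.trans {P Q R : Finset Face} (h : Congruent P Q) (h' : Congruent Q R) :
    Congruent P R := by
  obtain ⟨z, v, rfl⟩ := h
  obtain ⟨z', v', rfl⟩ := h'
  refine ⟨z' + z, rotateVertex^[z'] v + v', ?_⟩
  simp only [Finset.image_image]
  refine Finset.image_congr fun f _ => ?_
  simp only [Function.comp_apply, rotate_iterate_translate, Function.iterate_add_apply]
  simp [translate, add_assoc]

theorem Congruent.symm {P Q : Finset Face} (h : Congruent P Q) : Congruent Q P := by
  obtain ⟨z, v, rfl⟩ := h
  -- Since six rotations are the identity, `5 * z` further rotations undo `z` of them.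
  refine ⟨5 * z, -rotateVertex^[5 * z] v, ?_⟩
  have h6 : ∀ f, rotate^[5 * z] (rotate^[z] f) = f := by
    intro f
    rw [← Function.iterate_add_apply, show 5 * z + z = 6 * z by ring, Function.iterate_mul]
    exact Function.iterate_fixed (rotate_iterate_six f) z
  simp only [Finset.image_image]
  conv_lhs => rw [← Finset.image_id (s := P)]
  refine Finset.image_congr fun f _ => ?_
  simp only [Function.comp_apply, rotate_iterate_translate, h6]
  simp [translate]

theorem congruent_hull_of_translate {x₀ x₁ y₀ y₁ z₀ z₁ x₀' x₁' y₀' y₁' z₀' z₁' : ℤ}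
    (hx : x₁' - x₀' = x₁ - x₀) (hy : y₁' - y₀' = y₁ - y₀) (hz : z₁' - z₀' = z₁ - z₀)
    (ht : z₀' - x₀' - y₀' = z₀ - x₀ - y₀) :
    Congruent (hull x₀ x₁ y₀ y₁ z₀ z₁) (hull x₀' x₁' y₀' y₁' z₀' z₁') := by
  refine ⟨0, (x₀' - x₀, y₀' - y₀), ?_⟩
  rw [Function.iterate_zero, Finset.image_id, image_translate_hull]
  dsimp only
  congr 1 <;> omega

theorem congruent_hull_rotate (x₀ x₁ y₀ y₁ z₀ z₁ : ℤ) :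
    Congruent (hull x₀ x₁ y₀ y₁ z₀ z₁) (hull (-y₁) (-y₀) z₀ z₁ x₀ x₁) := by
  refine ⟨1, 0, ?_⟩
  rw [Function.iterate_one, image_rotate_hull, image_translate_hull]
  simp

/-- Two hexagons whose widths and corner heights agree up to a rotation are congruent. -/
theorem congruent_hull {x₀ x₁ y₀ y₁ z₀ z₁ x₀' x₁' y₀' y₁' z₀' z₁' A B C t : ℤ}
    (hA : x₁ - x₀ = A) (hB : y₁ - y₀ = B) (hC : z₁ - z₀ = C) (ht : z₀ - x₀ - y₀ = t)
    (h : (x₁' - x₀' = A ∧ y₁' - y₀' = B ∧ z₁' - z₀' = C ∧ z₀' - x₀' - y₀' = t) ∨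
      (x₁' - x₀' = B ∧ y₁' - y₀' = C ∧ z₁' - z₀' = A ∧ z₀' - x₀' - y₀' = B - t) ∨
      (x₁' - x₀' = C ∧ y₁' - y₀' = A ∧ z₁' - z₀' = B ∧ z₀' - x₀' - y₀' = C - B + t) ∨
      (x₁' - x₀' = A ∧ y₁' - y₀' = B ∧ z₁' - z₀' = C ∧ z₀' - x₀' - y₀' = A - C + B - t) ∨
      (x₁' - x₀' = B ∧ y₁' - y₀' = C ∧ z₁' - z₀' = A ∧ z₀' - x₀' - y₀' = C - A + t) ∨
      (x₁' - x₀' = C ∧ y₁' - y₀' = A ∧ z₁' - z₀' = B ∧ z₀' - x₀' - y₀' = A - t)) :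
    Congruent (hull x₀ x₁ y₀ y₁ z₀ z₁) (hull x₀' x₁' y₀' y₁' z₀' z₁') := by
  -- The widths `A`, `B`, `C` and the corner height `t` determine the hexagon up to translation. One
  -- rotation sends `(A, B, C, t)` to `(B, C, A, B - t)`; the six alternatives are its iterates.
  have r1 := congruent_hull_rotate x₀ x₁ y₀ y₁ z₀ z₁
  have r2 := r1.trans (congruent_hull_rotate _ _ _ _ _ _)
  have r3 := r2.trans (congruent_hull_rotate _ _ _ _ _ _)
  have r4 := r3.trans (congruent_hull_rotate _ _ _ _ _ _)
  have r5 := r4.trans (congruent_hull_rotate _ _ _ _ _ _)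
  rcases h with h | h | h | h | h | h
  · exact congruent_hull_of_translate (by omega) (by omega) (by omega) (by omega)
  · exact r1.trans (congruent_hull_of_translate (by omega) (by omega) (by omega) (by omega))
  · exact r2.trans (congruent_hull_of_translate (by omega) (by omega) (by omega) (by omega))
  · exact r3.trans (congruent_hull_of_translate (by omega) (by omega) (by omega) (by omega))
  · exact r4.trans (congruent_hull_of_translate (by omega) (by omega) (by omega) (by omega))
  · exact r5.trans (congruent_hull_of_translate (by omega) (by omega) (by omega) (by omega))

/-! ### Quasi-regular hexagons as hexagons -/

theorem regularHexagon_eq (r : ℕ) : regularHexagon r = hull (-r) r (-r) r (-r) r := by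
  ext ⟨⟨x, y⟩, b⟩
  rw [regularHexagon, Finset.mem_filter, mem_hull]
  cases b <;> simp only [vertices, zIndex, abs_le, Finset.mem_product, Finset.mem_Icc,
    Finset.mem_univ, Finset.mem_insert, Finset.mem_singleton, forall_eq_or_imp, forall_eq,
    and_true] <;> constructor <;> intro h <;> omega

theorem triangle_eq (l : ℕ) : triangle l = hull 0 l 0 l 0 l := by
  ext ⟨⟨x, y⟩, b⟩
  rw [triangle, Finset.mem_filter, mem_hull]
  cases b <;> simp only [vertices, zIndex, Finset.mem_product, Finset.mem_Icc,
    Finset.mem_univ, Finset.mem_insert, Finset.mem_singleton, forall_eq_or_imp, forall_eq,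
    and_true] <;> constructor <;> intro h <;> omega

theorem bar_eq {l : ℕ} (hl : 1 ≤ l) : bar l = hull 0 l 0 1 0 l := by
  ext ⟨⟨x, y⟩, b⟩
  rw [bar, triangle_eq, triangle_eq, image_translate_hull, Finset.mem_sdiff, mem_hull, mem_hull,
    mem_hull]
  cases b <;> simp only [zIndex] <;> omega

/-- A bar is a hull of width one in one direction, so attaching it moves a single bounding line
outwards by one. The five bars move `y₁`, `x₀`, `z₀`, `y₀`, `x₁` in turn. -/
theorem quasiRegularHexagon_one {r : ℕ} (hr : 1 ≤ r) :
    quasiRegularHexagon r 1 = hull (-r) r (-r) (r + 1) (-r) r := by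
  rw [quasiRegularHexagon, quasiRegularHexagon, regularHexagon_eq, if_pos rfl, bar_eq hr,
    image_translate_hull, Function.iterate_zero, Finset.image_id]
  ext ⟨⟨x, y⟩, b⟩
  rw [Finset.mem_union, mem_hull, mem_hull, mem_hull]
  cases b <;> simp only [zIndex] <;> omega

theorem quasiRegularHexagon_two {r : ℕ} (hr : 1 ≤ r) :
    quasiRegularHexagon r 2 = hull (-r - 1) r (-r) (r + 1) (-r) r := by
  rw [quasiRegularHexagon, quasiRegularHexagon_one hr, if_neg (by norm_num), bar_eq (by omega),
    image_translate_hull]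
  simp only [Function.iterate_one, image_rotate_hull]
  ext ⟨⟨x, y⟩, b⟩
  rw [Finset.mem_union, mem_hull, mem_hull, mem_hull]
  cases b <;> simp only [zIndex] <;> omega

theorem quasiRegularHexagon_three {r : ℕ} (hr : 1 ≤ r) :
    quasiRegularHexagon r 3 = hull (-r - 1) r (-r) (r + 1) (-r - 1) r := by
  rw [quasiRegularHexagon, quasiRegularHexagon_two hr, if_neg (by norm_num), bar_eq (by omega),
    image_translate_hull]
  simp only [Function.iterate_succ, Function.iterate_zero, Function.id_comp, ← Finset.image_image,
    image_rotate_hull]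
  ext ⟨⟨x, y⟩, b⟩
  rw [Finset.mem_union, mem_hull, mem_hull, mem_hull]
  cases b <;> simp only [zIndex] <;> omega

theorem quasiRegularHexagon_four {r : ℕ} (hr : 1 ≤ r) :
    quasiRegularHexagon r 4 = hull (-r - 1) r (-r - 1) (r + 1) (-r - 1) r := by
  rw [quasiRegularHexagon, quasiRegularHexagon_three hr, if_neg (by norm_num), bar_eq (by omega),
    image_translate_hull]
  simp only [Function.iterate_succ, Function.iterate_zero, Function.id_comp, ← Finset.image_image,
    image_rotate_hull]
  ext ⟨⟨x, y⟩, b⟩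
  rw [Finset.mem_union, mem_hull, mem_hull, mem_hull]
  cases b <;> simp only [zIndex] <;> omega

theorem quasiRegularHexagon_five {r : ℕ} (hr : 1 ≤ r) :
    quasiRegularHexagon r 5 = hull (-r - 1) (r + 1) (-r - 1) (r + 1) (-r - 1) r := by
  rw [quasiRegularHexagon, quasiRegularHexagon_four hr, if_neg (by norm_num), bar_eq (by omega),
    image_translate_hull]
  simp only [Function.iterate_succ, Function.iterate_zero, Function.id_comp, ← Finset.image_image,
    image_rotate_hull]
  ext ⟨⟨x, y⟩, b⟩
  rw [Finset.mem_union, mem_hull, mem_hull, mem_hull]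
  cases b <;> simp only [zIndex] <;> omega

/-- The hexagon `E_{B_i}(r)` in strip coordinates. -/
theorem quasiRegularHexagon_eq {r i : ℕ} (hr : 1 ≤ r) (hi : i ≤ 5) :
    quasiRegularHexagon r i =
      hull (-r - if 2 ≤ i then 1 else 0) (r + if 5 ≤ i then 1 else 0)
        (-r - if 4 ≤ i then 1 else 0) (r + if 1 ≤ i then 1 else 0)
        (-r - if 3 ≤ i then 1 else 0) r := by
  interval_cases i
  · simpa [quasiRegularHexagon] using regularHexagon_eq r
  · simpa using quasiRegularHexagon_one hr
  · simpa using quasiRegularHexagon_two hr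
  · simpa using quasiRegularHexagon_three hr
  · simpa using quasiRegularHexagon_four hr
  · simpa using quasiRegularHexagon_five hr

theorem edgePerimeter_quasiRegularHexagon_le {r i : ℕ} (hr : 1 ≤ r) (hi : i ≤ 5) :
    edgePerimeter (quasiRegularHexagon r i) ≤ 6 * r + i := by
  rw [quasiRegularHexagon_eq hr hi]
  have h := edgePerimeter_hull_le (x₀ := -r - if 2 ≤ i then 1 else 0)
    (x₁ := r + if 5 ≤ i then 1 else 0) (y₀ := -r - if 4 ≤ i then 1 else 0)
    (y₁ := r + if 1 ≤ i then 1 else 0) (z₀ := -r - if 3 ≤ i then 1 else 0) (z₁ := r)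
    (by split_ifs <;> omega) (by split_ifs <;> omega) (by split_ifs <;> omega)
    (by split_ifs <;> omega) (by split_ifs <;> omega) (by split_ifs <;> omega)
  refine Nat.cast_le.1 (h.trans ?_)
  push_cast
  split_ifs <;> omega

theorem isPolyiamond_quasiRegularHexagon {r i : ℕ} (hr : 1 ≤ r) (hi : i ≤ 5) :
    IsPolyiamond (quasiRegularHexagon r i) := by
  rw [quasiRegularHexagon_eq hr hi]
  apply isPolyiamond_hull <;> (try split_ifs) <;> omega

/-- `n² - 6 A`, where `n = 6 r + i` is the perimeter and `A` the area of `E_{B_i}(r)`. -/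
def defect (i : ℕ) : ℤ := if i = 0 then 0 else if i = 3 then 3 else if i = 1 ∨ i = 5 then 7 else 4

theorem six_mul_area_quasiRegularHexagon {r i : ℕ} (hr : 1 ≤ r) (hi : i ≤ 5) :
    6 * (area (quasiRegularHexagon r i) : ℤ) = (6 * r + i) ^ 2 - defect i := by
  rw [quasiRegularHexagon_eq hr hi, area]
  rw [card_hull]
  · interval_cases i <;> simp [defect] <;> ring
  all_goals split_ifs <;> omega

/-! ### The isoperimetric inequality -/

/-- The hypotheses give `(6r + i)² - 7 ≤ n²`, while `(6r + i)²` exceeds the preceding square by at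
least `11`, because `6r + i ≥ 6`. -/
theorem le_semiWidth_of_area_le {r i : ℕ} (hr : 1 ≤ r) (hi : i ≤ 5) {N n : ℤ}
    (hN : (area (quasiRegularHexagon r i) : ℤ) ≤ N) (hn : 0 ≤ n) (hform : 6 * N ≤ n ^ 2) :
    6 * r + i ≤ n := by
  have hM := six_mul_area_quasiRegularHexagon hr hi
  have hr' : (1 : ℤ) ≤ r := by exact_mod_cast hr
  have hdef : defect i ≤ 7 := by
    rw [defect]; split_ifs <;> norm_num
  by_contra! hlt
  have : n ^ 2 ≤ (6 * r + i - 1 : ℤ) ^ 2 := pow_le_pow_left₀ hn (by omega) 2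
  nlinarith

/-- A polyiamond with at least the area of `E_{B_i}(r)` has site-perimeter at least `6 r + i`. -/
theorem le_sitePerimeter_of_area_le {P : Finset Face} (hP : IsPolyiamond P) {r i : ℕ} (hr : 1 ≤ r)
    (hi : i ≤ 5) (harea : area (quasiRegularHexagon r i) ≤ area P) :
    6 * r + i ≤ sitePerimeter P := by
  obtain ⟨x₀, x₁, y₀, y₁, z₀, z₁, hsub, hx, hy, hz, h₁, h₂, h₃, h₄, h₅, h₆, hn⟩ := exists_hull hP
  have hN := card_hull h₁ h₂ h₃ h₄ h₅ h₆ hz.le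
  have hle : (area (quasiRegularHexagon r i) : ℤ) ≤ ((hull x₀ x₁ y₀ y₁ z₀ z₁).card : ℤ) :=
    Nat.cast_le.2 (harea.trans (Finset.card_le_card hsub))
  -- The three squares supplied are those in `n² - 6N = a² + 3d² + 3w²`.
  have h := le_semiWidth_of_area_le hr hi hle
    (n := (x₁ - x₀) + (y₁ - y₀) + (z₁ - z₀)) (by omega) (by
      rw [hN]
      nlinarith [sq_nonneg (x₁ - x₀ + (y₁ - y₀) - 2 * (z₀ - x₀ - y₀) - 2 * (x₁ + y₁ - z₁)),
        sq_nonneg (x₁ - x₀ - (y₁ - y₀)), sq_nonneg (z₀ - x₀ - y₀ - (x₁ + y₁ - z₁))])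
  zify
  exact h.trans hn

set_option maxHeartbeats 4000000 in
/-- A polyiamond with at least the area and at most the site-perimeter of `E_{B_i}(r)` is congruent
to it. -/
theorem congruent_of_area_le {P : Finset Face} (hP : IsPolyiamond P) {r i : ℕ} (hr : 1 ≤ r)
    (hi : i ≤ 5) (harea : area (quasiRegularHexagon r i) ≤ area P)
    (hs : sitePerimeter P ≤ 6 * r + i) : Congruent (quasiRegularHexagon r i) P := by
  obtain ⟨x₀, x₁, y₀, y₁, z₀, z₁, hsub, hx, hy, hz, h₁, h₂, h₃, h₄, h₅, h₆, hn⟩ := exists_hull hP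
  have hN := card_hull h₁ h₂ h₃ h₄ h₅ h₆ hz.le
  have hle : (area P : ℤ) ≤ ((hull x₀ x₁ y₀ y₁ z₀ z₁).card : ℤ) :=
    Nat.cast_le.2 (Finset.card_le_card hsub)
  have hM := six_mul_area_quasiRegularHexagon hr hi
  have harea' : (area (quasiRegularHexagon r i) : ℤ) ≤ area P := Nat.cast_le.2 harea
  have hs' : (sitePerimeter P : ℤ) ≤ 6 * r + i := by exact_mod_cast hs
  -- Coordinates that diagonalise the quadratic form `n² - 6N`: `d` compares two widths, `w`
  -- compares the two cut-off corners, and `a` compares the widths with the corners. All vanish for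
  -- a regular hexagon.
  obtain ⟨a, ha⟩ : ∃ a, a = x₁ - x₀ + (y₁ - y₀) - 2 * (z₀ - x₀ - y₀) - 2 * (x₁ + y₁ - z₁) := ⟨_, rfl⟩
  obtain ⟨d, hd⟩ : ∃ d, d = x₁ - x₀ - (y₁ - y₀) := ⟨_, rfl⟩
  obtain ⟨w, hw⟩ : ∃ w, w = z₀ - x₀ - y₀ - (x₁ + y₁ - z₁) := ⟨_, rfl⟩
  obtain ⟨n, hn'⟩ : ∃ n, n = (x₁ - x₀) + (y₁ - y₀) + (z₁ - z₀) := ⟨_, rfl⟩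
  have hform : n ^ 2 - 6 * ((hull x₀ x₁ y₀ y₁ z₀ z₁).card : ℤ) = a ^ 2 + 3 * d ^ 2 + 3 * w ^ 2 := by
    rw [hN, ha, hd, hw, hn']; ring
  have hdef : defect i ≤ 7 := by
    rw [defect]; split_ifs <;> norm_num
  have hneq : n = 6 * r + i := le_antisymm (by omega)
    (le_semiWidth_of_area_le hr hi (harea'.trans hle) (by omega)
      (by linarith [sq_nonneg a, sq_nonneg d, sq_nonneg w]))
  have hq : a ^ 2 + 3 * d ^ 2 + 3 * w ^ 2 ≤ defect i := by
    rw [← hform, hneq]; linarith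
  -- If the form is not below `defect i`, the hull has no more faces than `P`, so `P` is all of it.
  have heq : defect i ≤ a ^ 2 + 3 * d ^ 2 + 3 * w ^ 2 →
      P = hull x₀ x₁ y₀ y₁ z₀ z₁ := by
    intro h
    refine Finset.eq_of_subset_of_card_le hsub ?_
    rw [← hform, hneq] at h
    have : ((hull x₀ x₁ y₀ y₁ z₀ z₁).card : ℤ) ≤ area P := by linarith
    exact_mod_cast this
  have ha7 : a ^ 2 ≤ 7 := by linarith [sq_nonneg d, sq_nonneg w]
  have hd7 : 3 * d ^ 2 ≤ 7 := by linarith [sq_nonneg a, sq_nonneg w]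
  have hw7 : 3 * w ^ 2 ≤ 7 := by linarith [sq_nonneg a, sq_nonneg d]
  have ha2 : -2 ≤ a ∧ a ≤ 2 := by constructor <;> nlinarith only [ha7]
  have hd1 : -1 ≤ d ∧ d ≤ 1 := by constructor <;> nlinarith only [hd7]
  have hw1 : -1 ≤ w ∧ w ≤ 1 := by constructor <;> nlinarith only [hw7]
  have key : defect i ≤ a ^ 2 + 3 * d ^ 2 + 3 * w ^ 2 ∧
      Congruent (quasiRegularHexagon r i) (hull x₀ x₁ y₀ y₁ z₀ z₁) := by
    clear heq hform hN hM ha7 hd7 hw7 hle harea harea' hs hs' hsub hP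
    rw [quasiRegularHexagon_eq hr hi]
    obtain ⟨ha2, ha2'⟩ := ha2
    obtain ⟨hd1, hd1'⟩ := hd1
    obtain ⟨hw1, hw1'⟩ := hw1
    -- Integrality of the sides forces `a ≡ -i` modulo `3`, and `a ≡ d`, `w ≡ i` modulo `2`. Under
    -- these congruences `defect i` is the least value of the form, and each triple attaining it is
    -- a rotation of the standard hexagon.
    interval_cases i <;> interval_cases a <;> interval_cases d <;> interval_cases w <;>
      first
        | (exfalso; norm_num [defect] at hq; done)
        | (exfalso; push_cast at hneq; omega)
        | (refine ⟨by norm_num [defect], ?_⟩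
           refine congruent_hull rfl rfl rfl rfl ?_
           norm_num at hneq ⊢
           omega)
  rw [heq key.1]
  exact key.2

/-- For the standard hexagon `6r + i ≤ s ≤ p ≤ 6r + i`, from strip counting, `s ≤ p` and the side
lengths; lattice symmetries preserve both perimeters. -/
theorem perimeters_of_congruent {E : Finset Face} {r i : ℕ} (hr : 1 ≤ r) (hi : i ≤ 5)
    (h : Congruent (quasiRegularHexagon r i) E) :
    area E = area (quasiRegularHexagon r i) ∧ IsPolyiamond E ∧ edgePerimeter E = 6 * r + i ∧
      sitePerimeter E = 6 * r + i := by
  obtain ⟨φ, hφ, rfl⟩ := h.exists_symmetry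
  have hP := isPolyiamond_quasiRegularHexagon hr hi
  have hle := edgePerimeter_quasiRegularHexagon_le hr hi
  have hsp := sitePerimeter_le_edgePerimeter (quasiRegularHexagon r i)
  refine ⟨Finset.card_image_of_injective _ hφ.1.1, hφ.isPolyiamond_image hP, ?_⟩
  rw [hφ.edgePerimeter_image, hφ.sitePerimeter_image]
  have := le_sitePerimeter_of_area_le hP hr hi le_rfl
  omega

end Polyiamond

theorem mainTheorem9 (E : Finset Polyiamond.Face) (hE : Polyiamond.IsQuasiRegularHexagon E) :
    (∀ P : Finset Polyiamond.Face, Polyiamond.IsPolyiamond P →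
      ¬ Polyiamond.IsQuasiRegularHexagon P → Polyiamond.area E ≤ Polyiamond.area P →
      Polyiamond.edgePerimeter E < Polyiamond.edgePerimeter P ∧
      Polyiamond.sitePerimeter E < Polyiamond.sitePerimeter P) ∧
    Polyiamond.IsPolyiamond E ∧
    (∀ P : Finset Polyiamond.Face, Polyiamond.IsPolyiamond P →
      Polyiamond.area P = Polyiamond.area E →
      Polyiamond.edgePerimeter E ≤ Polyiamond.edgePerimeter P ∧
      (Polyiamond.edgePerimeter P = Polyiamond.edgePerimeter E ↔ Polyiamond.Congruent E P) ∧
      Polyiamond.sitePerimeter E ≤ Polyiamond.sitePerimeter P ∧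
      (Polyiamond.sitePerimeter P = Polyiamond.sitePerimeter E ↔ Polyiamond.Congruent E P)) := by
  obtain ⟨r, i, hr, hi, hE⟩ := hE
  obtain ⟨hA, hEP, hp, hs⟩ := Polyiamond.perimeters_of_congruent hr hi hE
  have hcongr : ∀ P : Finset Polyiamond.Face, Polyiamond.IsPolyiamond P →
      Polyiamond.area E ≤ Polyiamond.area P → Polyiamond.sitePerimeter P ≤ 6 * r + i →
      Polyiamond.Congruent (Polyiamond.quasiRegularHexagon r i) P :=
    fun P hP ha h => Polyiamond.congruent_of_area_le hP hr hi (hA ▸ ha) h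
  refine ⟨fun P hP hQ ha => ?_, hEP, fun P hP ha => ?_⟩
  · have hsp := Polyiamond.sitePerimeter_le_edgePerimeter P
    have hlt : 6 * r + i < Polyiamond.sitePerimeter P := by
      by_contra! h
      exact hQ ⟨r, i, hr, hi, hcongr P hP ha h⟩
    omega
  · have hsp := Polyiamond.sitePerimeter_le_edgePerimeter P
    have hle := Polyiamond.le_sitePerimeter_of_area_le hP hr hi (hA ▸ ha.ge)
    have hEq : Polyiamond.sitePerimeter P ≤ 6 * r + i → Polyiamond.Congruent E P :=
      fun h => hE.symm.trans (hcongr P hP ha.ge h)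
    have hEq' : Polyiamond.Congruent E P →
        Polyiamond.edgePerimeter P = 6 * r + i ∧ Polyiamond.sitePerimeter P = 6 * r + i :=
      fun h => (Polyiamond.perimeters_of_congruent hr hi (hE.trans h)).2.2
    rw [hp, hs]
    -- Equality of edge-perimeters already gives `s(P) ≤ p(P) = 6r + i`, so both equality cases
    -- reduce to the site-perimeter.
    exact ⟨hle.trans hsp, ⟨fun h => hEq (hsp.trans h.le), fun h => (hEq' h).1⟩, hle,
      ⟨fun h => hEq h.le, fun h => (hEq' h).2⟩⟩
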